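/- All manifolds and tensor fields are $C^\infty$. An almost coquaternion metric structure on a $(4n+3)$-dimensional manifold $M$ consists of endomorphism fields $\phi_a$ of $TM$, vector fields $\xi_a$ and 1-forms $\eta_a$ ($a=1,2,3$) and a Riemannian metric $g$ on $M$ such that $\phi_a^2=-\mathrm{id}+\xi_a\otimes\eta_a$, $\eta_a(\xi_a)=1$, $\eta_a(X)=g(\xi_a,X)$, $g(\phi_aX,\phi_aY)=g(X,Y)-\eta_a(X)\eta_a(Y)$, and, for every cyclic permutation $(a,b,c)$ of $(1,2,3)$, $$\phi_a\circ\phi_b-\xi_a\otimes\eta_b=-\phi_b\circ\phi_a+\xi_b\otimes\eta_a=\phi_c,\quad \phi_a\xi_b=-\phi_b\xi_a=\xi_c,\quad \eta_a\circ\phi_b=-\eta_b\circ\phi_a=\eta_c,\quad \eta_a(\xi_b)=\eta_b(\xi_a)=0,$$ where $(\xi\otimes\eta)(X)=\eta(X)\xi$. $M$ with such a structure is called an almost coquaternion Riemannian manifold. An almost quaternion Hermitian structure on a manifold consists of three almost complex structures $J_a$ with $J_aJ_b=-J_bJ_a=J_c$ for cyclic $(a,b,c)$ and a Riemannian metric $G$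 with $G(J_aX,J_aY)=G(X,Y)$. It is said to induce the structure $(\phi_a,\xi_a,\eta_a,g)$ on a hypersurface $i:M\to\overline M$ with unit normal field $\nu$ if $J_a i_*X=i_*\phi_aX-\eta_a(X)\nu$, $J_a\nu=i_*\xi_a$ and $G(i_*X,i_*Y)=g(X,Y)$. **Theorem 4.4.** Let $M$ be an almost coquaternion Riemannian manifold with structure $(\phi_a,\xi_a,\eta_a,g)$. Then $$J_a(X,r)=(\phi_aX+r\,\xi_a,\,-\eta_a(X)),\qquad G=g+dt^2$$ is an almost quaternion Hermitian structure on $M\times\mathbb R$. For every $t_0\in\mathbb R$ the map $x\mapsto(x,t_0)$ is a smooth embedding of $M$ as a totally geodesic hypersurface of $(M\times\mathbb R,G)$, with a smooth unit normal field, on which $(J_a,G)$ induces the given structure of $M$. Moreover there is a Riemannian metric $G'$ on $M\times\mathbb R$ such that $(J_a,G')$, with the same $J_a$, is almost quaternion Hermitian and $x\mapsto(x,0)$ is a smooth embedding of $M$ as a totally umbilical hypersurface of $(M\times\mathbb R,G')$, with a smooth unit normal field, whose second fundamental form is $\lambda g$ with $\lambda$ nowhere zero, and on which $(J_a,G')$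 induces the given structure of $M$. -/

import Mathlib

open Bundle
open scoped Manifold ContDiff Topology

noncomputable section

section Structures

variable {E : Type*} [NormedAddCommGroup E] [NormedSpace ℝ E]
  {H : Type*} [TopologicalSpace H] (I : ModelWithCorners ℝ E H)
  (M : Type*) [TopologicalSpace M] [ChartedSpace H M] [IsManifold I ∞ M]

/-- Smooth Riemannian metrics on the manifold `M`. -/
abbrev SmoothRiemannianMetric : Type _ :=
  ContMDiffRiemannianMetric I ∞ E (fun x : M => TangentSpace I x)

/-- An almost cocomplex structure `(φ, ξ, η)` on `M` (also called an almost contact structure): a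
smooth field of endomorphisms `φ`, a smooth vector field `ξ` and a smooth 1-form `η` with
`φ² = -id + ξ ⊗ η` and `η(ξ) = 1`. -/
structure AlmostCocomplexStructure where
  φ (x : M) : TangentSpace I x →L[ℝ] TangentSpace I x
  ξ (x : M) : TangentSpace I x
  η (x : M) : TangentSpace I x →L[ℝ] ℝ
  smooth_φ : ContMDiff I (I.prod 𝓘(ℝ, E →L[ℝ] E)) ∞
    (fun x => TotalSpace.mk' (E →L[ℝ] E)
      (E := fun x : M => TangentSpace I x →L[ℝ] TangentSpace I x) x (φ x))
  smooth_ξ : ContMDiff I (I.prod 𝓘(ℝ, E)) ∞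
    (fun x => TotalSpace.mk' E (E := fun x : M => TangentSpace I x) x (ξ x))
  smooth_η : ContMDiff I (I.prod 𝓘(ℝ, E →L[ℝ] ℝ)) ∞
    (fun x => TotalSpace.mk' (E →L[ℝ] ℝ) (E := fun x : M => TangentSpace I x →L[ℝ] ℝ) x (η x))
  φ_φ (x : M) (X : TangentSpace I x) : φ x (φ x X) = -X + η x X • ξ x
  η_ξ (x : M) : η x (ξ x) = 1

/-- An almost coquaternion structure `(φ_a, ξ_a, η_a)` on `M`: three almost cocomplex structures
satisfying the relations below for every cyclic permutation `(a, b, c)` of the three indices, that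
is, for `(a, b, c) = (a, a + 1, a + 2)` in `Fin 3`. Here `(ξ ⊗ η) X = η(X) ξ`. -/
structure AlmostCoquaternionStructure where
  str : Fin 3 → AlmostCocomplexStructure I M
  φ_comp (a : Fin 3) (x : M) (X : TangentSpace I x) :
    (str a).φ x ((str (a + 1)).φ x X) - (str (a + 1)).η x X • (str a).ξ x = (str (a + 2)).φ x X
  φ_comp' (a : Fin 3) (x : M) (X : TangentSpace I x) :
    -(str (a + 1)).φ x ((str a).φ x X) + (str a).η x X • (str (a + 1)).ξ x = (str (a + 2)).φ x X
  φ_ξ (a : Fin 3) (x : M) : (str a).φ x ((str (a + 1)).ξ x) = (str (a + 2)).ξ x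
  φ_ξ' (a : Fin 3) (x : M) : -(str (a + 1)).φ x ((str a).ξ x) = (str (a + 2)).ξ x
  η_φ (a : Fin 3) (x : M) (X : TangentSpace I x) :
    (str a).η x ((str (a + 1)).φ x X) = (str (a + 2)).η x X
  η_φ' (a : Fin 3) (x : M) (X : TangentSpace I x) :
    -(str (a + 1)).η x ((str a).φ x X) = (str (a + 2)).η x X
  η_ξ (a : Fin 3) (x : M) : (str a).η x ((str (a + 1)).ξ x) = 0
  η_ξ' (a : Fin 3) (x : M) : (str (a + 1)).η x ((str a).ξ x) = 0

/-- An almost coquaternion metric structure `(φ_a, ξ_a, η_a, g)` on `M`. A manifold with such a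
structure is an almost coquaternion Riemannian manifold. -/
structure AlmostCoquaternionMetricStructure extends AlmostCoquaternionStructure I M where
  g : SmoothRiemannianMetric I M
  η_eq (a : Fin 3) (x : M) (X : TangentSpace I x) : (str a).η x X = g.inner x ((str a).ξ x) X
  g_φ (a : Fin 3) (x : M) (X Y : TangentSpace I x) :
    g.inner x ((str a).φ x X) ((str a).φ x Y) =
      g.inner x X Y - (str a).η x X * (str a).η x Y

/-- An almost quaternion Hermitian structure `(J_a, G)` on `M`: three smooth almost complex
structures with `J_a J_b = -J_b J_a = J_c` for every cyclic permutation `(a, b, c)` of the indices,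
and a smooth Riemannian metric `G` for which every `J_a` is orthogonal. -/
structure AlmostQuaternionHermitianStructure where
  J (a : Fin 3) (x : M) : TangentSpace I x →L[ℝ] TangentSpace I x
  smooth_J (a : Fin 3) : ContMDiff I (I.prod 𝓘(ℝ, E →L[ℝ] E)) ∞
    (fun x => TotalSpace.mk' (E →L[ℝ] E)
      (E := fun x : M => TangentSpace I x →L[ℝ] TangentSpace I x) x (J a x))
  J_J (a : Fin 3) (x : M) (X : TangentSpace I x) : J a x (J a x X) = -X
  J_comp (a : Fin 3) (x : M) (X : TangentSpace I x) : J a x (J (a + 1) x X) = J (a + 2) x X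
  J_comp' (a : Fin 3) (x : M) (X : TangentSpace I x) : J (a + 1) x (J a x X) = -J (a + 2) x X
  G : SmoothRiemannianMetric I M
  G_J (a : Fin 3) (x : M) (X Y : TangentSpace I x) :
    G.inner x (J a x X) (J a x Y) = G.inner x X Y

end Structures

section Hypersurfaces

variable {E : Type*} [NormedAddCommGroup E] [NormedSpace ℝ E]
  {H : Type*} [TopologicalSpace H] (I : ModelWithCorners ℝ E H)
  {M : Type*} [TopologicalSpace M] [ChartedSpace H M] [IsManifold I ∞ M]
  {E' : Type*} [NormedAddCommGroup E'] [NormedSpace ℝ E']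
  {H' : Type*} [TopologicalSpace H'] {J : ModelWithCorners ℝ E' H'}
  {N : Type*} [TopologicalSpace N] [ChartedSpace H' N] [IsManifold J ∞ N]

/-- `D` is the Levi-Civita connection of `G`: it is torsion-free, `D_X Y - D_Y X = [X, Y]`, and
metric, `u G(Y, Z) = G(D_u Y, Z) + G(Y, D_u Z)`. In Mathlib, `D_u Y` at `y` is `D Y y u`. -/
structure IsLeviCivita (G : SmoothRiemannianMetric J N)
    (D : CovariantDerivative J E' (fun y : N => TangentSpace J y)) : Prop where
  torsion_free (X Y : (y : N) → TangentSpace J y) (y : N)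
    (hX : MDifferentiableAt J (J.prod 𝓘(ℝ, E'))
      (fun z => TotalSpace.mk' E' (E := fun z : N => TangentSpace J z) z (X z)) y)
    (hY : MDifferentiableAt J (J.prod 𝓘(ℝ, E'))
      (fun z => TotalSpace.mk' E' (E := fun z : N => TangentSpace J z) z (Y z)) y) :
    D Y y (X y) - D X y (Y y) = VectorField.mlieBracket J X Y y
  metric (Y Z : (y : N) → TangentSpace J y) (y : N)
    (hY : MDifferentiableAt J (J.prod 𝓘(ℝ, E'))
      (fun z => TotalSpace.mk' E' (E := fun z : N => TangentSpace J z) z (Y z)) y)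
    (hZ : MDifferentiableAt J (J.prod 𝓘(ℝ, E'))
      (fun z => TotalSpace.mk' E' (E := fun z : N => TangentSpace J z) z (Z z)) y)
    (u : TangentSpace J y) :
    (mfderiv J 𝓘(ℝ, ℝ) (fun z => G.inner z (Y z) (Z z)) y u : ℝ) =
      G.inner y (D Y y u) (Z y) + G.inner y (Y y) (D Z y u)

/-- `i : M → N` is a smoothly embedded hypersurface of the Riemannian manifold `(N, G)` and `ν` is
a smooth field of unit normal vectors along it. -/
structure IsHypersurfaceWithUnitNormal (G : SmoothRiemannianMetric J N) (i : M → N)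
    (ν : (p : M) → TangentSpace J (i p)) : Prop where
  codim_one : Module.finrank ℝ E' = Module.finrank ℝ E + 1
  embedding : Manifold.IsSmoothEmbedding I J ∞ i
  smooth : ContMDiff I (J.prod 𝓘(ℝ, E')) ∞
    (fun p => TotalSpace.mk' E' (E := fun y : N => TangentSpace J y) (i p) (ν p))
  unit (p : M) : G.inner (i p) (ν p) (ν p) = 1
  normal (p : M) (u : TangentSpace I p) : G.inner (i p) (ν p) (mfderiv I J i p u) = 0

/-- `h` is the second fundamental form, with respect to the unit normal field `ν`, of the
hypersurface `i : M → N` in `(N, G)`: with `D` the Levi-Civita connection of `G`, one has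
`h(u, Y) = G(D_{i_* u} Z, ν)` for all tangent vectors `u` and vector fields `Y` of `M`, where `Z` is
any vector field of `N` that extends `i_* Y` near the given point. -/
def IsSecondFundamentalForm (G : SmoothRiemannianMetric J N) (i : M → N)
    (ν : (p : M) → TangentSpace J (i p))
    (h : (p : M) → TangentSpace I p → TangentSpace I p → ℝ) : Prop :=
  ∃ D : CovariantDerivative J E' (fun y : N => TangentSpace J y), IsLeviCivita G D ∧
    ∀ (p : M) (u : TangentSpace I p)
      (Y : (q : M) → TangentSpace I q) (Z : (y : N) → TangentSpace J y),
      MDifferentiableAt J (J.prod 𝓘(ℝ, E'))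
        (fun y => TotalSpace.mk' E' (E := fun y : N => TangentSpace J y) y (Z y)) (i p) →
      (∀ᶠ q in 𝓝 p, Z (i q) = mfderiv I J i q (Y q)) →
      G.inner (i p) (D Z (i p) (mfderiv I J i p u)) (ν p) = h p u (Y p)

/-- The hypersurface `i` with unit normal field `ν` is totally geodesic: its second fundamental
form vanishes. -/
def IsTotallyGeodesic (G : SmoothRiemannianMetric J N) (i : M → N)
    (ν : (p : M) → TangentSpace J (i p)) : Prop :=
  IsSecondFundamentalForm I G i ν (fun _ _ _ => 0)

/-- The hypersurface `i` with unit normal field `ν` is totally umbilical with principal curvature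
function `lam`: its second fundamental form is `lam` times the induced metric. -/
def IsTotallyUmbilical (G : SmoothRiemannianMetric J N) (i : M → N)
    (ν : (p : M) → TangentSpace J (i p)) (lam : M → ℝ) : Prop :=
  IsSecondFundamentalForm I G i ν (fun p u v =>
    lam p * G.inner (i p) (mfderiv I J i p u) (mfderiv I J i p v))

variable {I} in
/-- The almost coquaternion metric structure that the almost quaternion Hermitian structure
`(J_a, G)` of `N` induces on the hypersurface `i` with unit normal field `ν` is the given one:
`φ_a X` is the tangential part of `J_a i_* X`, `η_a(X) = -G(ν, J_a i_* X)`, `i_* ξ_a = J_a ν`, and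
`g` is the induced metric. -/
structure InducesStructure (Q : AlmostQuaternionHermitianStructure J N) (i : M → N)
    (ν : (p : M) → TangentSpace J (i p)) (S : AlmostCoquaternionMetricStructure I M) : Prop where
  J_tangent (a : Fin 3) (p : M) (X : TangentSpace I p) :
    Q.J a (i p) (mfderiv I J i p X) =
      mfderiv I J i p ((S.str a).φ p X) - (S.str a).η p X • ν p
  J_normal (a : Fin 3) (p : M) : Q.J a (i p) (ν p) = mfderiv I J i p ((S.str a).ξ p)
  metric (p : M) (X Y : TangentSpace I p) :
    Q.G.inner (i p) (mfderiv I J i p X) (mfderiv I J i p Y) = S.g.inner p X Y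

end Hypersurfaces

end

/-! Both metrics have the form `f(t) (g + dt²)`: `f = 1` gives `G`, and `f(t) = exp (-2 t)` gives
`G'`. The operators `J_a` do not involve `f`, and a conformal factor does not affect their
orthogonality, so one family of constructions serves both halves of the theorem.

The quaternion relations are fibrewise algebra on `E × ℝ`: the corrections `ξ_a ⊗ η_b` in the
relations for the `φ_a` are exactly what the line coordinate contributes to `J_a J_b`. The only
extra facts needed are `φ_a ξ_a = 0` and `η_a ∘ φ_a = 0`, which follow from `φ_a² = -id + ξ_a ⊗ η_a`
and `η_a(ξ_a) = 1`. Smoothness reduces to that of the given tensors, because trivializations of the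
product are products of trivializations. On a slice with `f(t₀) = 1` the field `∂/∂t` is a unit
normal, and the induced structure is read off from `J_a(X, 0)` and `J_a(0, 1)`.

The geometric content is the second fundamental form (`isSecondFundamentalForm_slice`). In the
Koszul formula for `G(D_u Z, ∂/∂t)` with `u` and `Z` tangent to the slice, the metric is block
diagonal and only `-½ ∂_t G(u, Z)` survives, so the form is `-(f'(t₀)/2) g`. This is `0` for `f =
1`, and it is `g` at `t₀ = 0` for `f(t) = exp (-2 t)`.

The Levi-Civita connection is built in `exists_leviCivita`. Its axioms are pointwise, so at each `x`
the Koszul formula is used in the preferred chart at `x`, and no gluing is needed. -/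

noncomputable section

/-! ### Calculus of vector valued functions in the preferred chart. -/

section ChartDerivative

variable {E : Type*} [NormedAddCommGroup E] [NormedSpace ℝ E]
  {H : Type*} [TopologicalSpace H] (I : ModelWithCorners ℝ E H)
  {M : Type*} [TopologicalSpace M] [ChartedSpace H M]
  {F : Type*} [NormedAddCommGroup F] [NormedSpace ℝ F]
  {F' : Type*} [NormedAddCommGroup F'] [NormedSpace ℝ F']

/-- The derivative at `x` of a vector valued function, read in the preferred chart at `x`. -/
def chartDeriv (f : M → F) (x : M) : E →L[ℝ] F :=
  fderivWithin ℝ (f ∘ (extChartAt I x).symm) (Set.range I) (extChartAt I x x)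

variable {I} {x : M}

theorem MDifferentiableAt.hasFDerivWithinAt_chartDeriv {f : M → F}
    (hf : MDifferentiableAt I 𝓘(ℝ, F) f x) :
    HasFDerivWithinAt (f ∘ (extChartAt I x).symm) (chartDeriv I f x) (Set.range I)
      (extChartAt I x x) := by
  have h := hf.differentiableWithinAt_writtenInExtChartAt
  simp only [writtenInExtChartAt, extChartAt_model_space_eq_id, PartialEquiv.refl_coe,
    Function.id_comp] at h
  exact h.hasFDerivWithinAt

theorem HasFDerivWithinAt.chartDeriv_eq {f : M → F} {f' : E →L[ℝ] F}
    (h : HasFDerivWithinAt (f ∘ (extChartAt I x).symm) f' (Set.range I) (extChartAt I x x)) :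
    chartDeriv I f x = f' :=
  h.fderivWithin (I.uniqueDiffOn _ (Set.mem_range_self _))

theorem MDifferentiableAt.mfderiv_eq_chartDeriv {f : M → F}
    (hf : MDifferentiableAt I 𝓘(ℝ, F) f x) : mfderiv I 𝓘(ℝ, F) f x = chartDeriv I f x := by
  rw [hf.mfderiv]
  simp only [writtenInExtChartAt, extChartAt_model_space_eq_id, PartialEquiv.refl_coe,
    Function.id_comp]
  rfl

theorem Filter.EventuallyEq.chartDeriv_eq {f g : M → F} (h : f =ᶠ[𝓝 x] g) :
    chartDeriv I f x = chartDeriv I g x := by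
  have h1 : f ∘ (extChartAt I x).symm =ᶠ[𝓝 (extChartAt I x x)] g ∘ (extChartAt I x).symm := by
    have hc := continuousAt_extChartAt_symm (I := I) x
    rw [ContinuousAt, extChartAt_to_inv] at hc
    exact hc.eventually h
  refine (h1.filter_mono nhdsWithin_le_nhds).fderivWithin_eq ?_
  simpa using h.self_of_nhds

theorem chartDeriv_add {f g : M → F} (hf : MDifferentiableAt I 𝓘(ℝ, F) f x)
    (hg : MDifferentiableAt I 𝓘(ℝ, F) g x) :
    chartDeriv I (f + g) x = chartDeriv I f x + chartDeriv I g x :=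
  (hf.hasFDerivWithinAt_chartDeriv.add hg.hasFDerivWithinAt_chartDeriv).chartDeriv_eq

theorem chartDeriv_smul {c : M → ℝ} {f : M → F} (hc : MDifferentiableAt I 𝓘(ℝ, ℝ) c x)
    (hf : MDifferentiableAt I 𝓘(ℝ, F) f x) :
    chartDeriv I (c • f) x = c x • chartDeriv I f x + (chartDeriv I c x).smulRight (f x) := by
  have h := hc.hasFDerivWithinAt_chartDeriv.smul hf.hasFDerivWithinAt_chartDeriv
  simp only [Function.comp_apply, extChartAt_to_inv] at h
  exact h.chartDeriv_eq

/-- Applied twice to `G(Y, Z)`, this product rule gives the metric property of the connection. -/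
theorem chartDeriv_clm_apply {A : M → F →L[ℝ] F'} {f : M → F}
    (hA : MDifferentiableAt I 𝓘(ℝ, F →L[ℝ] F') A x) (hf : MDifferentiableAt I 𝓘(ℝ, F) f x)
    (u : E) :
    chartDeriv I (fun z => A z (f z)) x u = chartDeriv I A x u (f x) + A x (chartDeriv I f x u) := by
  have h := hA.hasFDerivWithinAt_chartDeriv.clm_apply hf.hasFDerivWithinAt_chartDeriv
  simp only [Function.comp_apply, extChartAt_to_inv] at h
  rw [HasFDerivWithinAt.chartDeriv_eq (f := fun z => A z (f z)) h]
  simp [add_comm]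

end ChartDerivative

/-! ### Vector fields, Lie brackets and metrics in the preferred trivialization. -/

section Coordinates

variable {E : Type*} [NormedAddCommGroup E] [NormedSpace ℝ E]
  {H : Type*} [TopologicalSpace H] {I : ModelWithCorners ℝ E H}
  {M : Type*} [TopologicalSpace M] [ChartedSpace H M] [IsManifold I ∞ M]

/-- A vector field read in the preferred trivialization of the tangent bundle at `x`. -/
def vectorFieldCoord (x : M) (Y : (z : M) → TangentSpace I z) (z : M) : E :=
  (trivializationAt E (fun z : M => TangentSpace I z) x
    (TotalSpace.mk' E (E := fun z : M => TangentSpace I z) z (Y z))).2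

/-- The bridge from bundle coordinates to derivatives: a tangent trivialization is the differential
of the chart, hence visibly linear and compatible with products. -/
theorem trivializationAt_snd_eq_mfderiv (x : M) {z : M} (hz : z ∈ (chartAt H x).source)
    (v : TangentSpace I z) :
    (trivializationAt E (fun z : M => TangentSpace I z) x
      (TotalSpace.mk' E (E := fun z : M => TangentSpace I z) z v)).2 =
      mfderiv I 𝓘(ℝ, E) (extChartAt I x) z v := by
  rw [← TangentBundle.continuousLinearMapAt_trivializationAt hz]
  exact (congrFun (Trivialization.coe_linearMapAt_of_mem
    (R := ℝ) (trivializationAt E (fun z : M => TangentSpace I z) x) hz) v).symm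

theorem vectorFieldCoord_eq_mfderiv (x : M) (Y : (z : M) → TangentSpace I z) {z : M}
    (hz : z ∈ (chartAt H x).source) :
    vectorFieldCoord x Y z = mfderiv I 𝓘(ℝ, E) (extChartAt I x) z (Y z) :=
  trivializationAt_snd_eq_mfderiv x hz (Y z)

/-- The preferred chart at `x` has identity differential at `x`, so at the centre no change of
coordinates intervenes. -/
theorem vectorFieldCoord_self (x : M) (Y : (z : M) → TangentSpace I z) :
    vectorFieldCoord x Y x = Y x := by
  rw [vectorFieldCoord_eq_mfderiv x Y (mem_chart_source H x), mfderiv_extChartAt_self]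
  rfl

theorem mdifferentiableAt_vectorFieldCoord {x : M} {Y : (z : M) → TangentSpace I z}
    (hY : MDifferentiableAt I (I.prod 𝓘(ℝ, E))
      (fun z => TotalSpace.mk' E (E := fun z : M => TangentSpace I z) z (Y z)) x) :
    MDifferentiableAt I 𝓘(ℝ, E) (vectorFieldCoord x Y) x :=
  ((mdifferentiableAt_totalSpace _ _).1 hY).2

theorem vectorFieldCoord_add (x : M) (Y Z : (z : M) → TangentSpace I z) :
    vectorFieldCoord x (Y + Z) =ᶠ[𝓝 x] vectorFieldCoord x Y + vectorFieldCoord x Z := by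
  filter_upwards [chart_source_mem_nhds H x] with z hz
  simp only [Pi.add_apply, vectorFieldCoord_eq_mfderiv x _ hz]
  exact map_add _ _ _

theorem vectorFieldCoord_smul (x : M) (c : M → ℝ) (Y : (z : M) → TangentSpace I z) :
    vectorFieldCoord x (c • Y) =ᶠ[𝓝 x] c • vectorFieldCoord x Y := by
  filter_upwards [chart_source_mem_nhds H x] with z hz
  simp only [Pi.smul_apply', vectorFieldCoord_eq_mfderiv x _ hz]
  exact map_smul _ _ _

/-- The bracket is defined by pulling back along the inverse chart. The differentials of the chart
and of its inverse are mutually inverse, so the pulled back field is the coordinate field, and the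
classical formula `dY(X) - dX(Y)` results. -/
theorem mlieBracket_eq_chartDeriv (x : M) (X Y : (z : M) → TangentSpace I z) :
    VectorField.mlieBracket I X Y x =
      (chartDeriv I (vectorFieldCoord x Y) x (X x) - chartDeriv I (vectorFieldCoord x X) x (Y x) :
        E) := by
  have key (V : (z : M) → TangentSpace I z) :
      VectorField.mpullbackWithin 𝓘(ℝ, E) I (extChartAt I x).symm V (Set.range I)
        =ᶠ[𝓝[Set.range I] (extChartAt I x x)] vectorFieldCoord x V ∘ (extChartAt I x).symm := by
    filter_upwards [extChartAt_target_mem_nhdsWithin x] with e he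
    have hs : (extChartAt I x).symm e ∈ (chartAt H x).source := by
      rw [← extChartAt_source (I := I)]; exact (extChartAt I x).map_target he
    rw [Function.comp_apply, vectorFieldCoord_eq_mfderiv x V hs, VectorField.mpullbackWithin_apply]
    congr 1
    exact ContinuousLinearMap.inverse_eq
      (mfderivWithin_extChartAt_symm_comp_mfderiv_extChartAt he)
      (mfderiv_extChartAt_comp_mfderivWithin_extChartAt_symm he)
  have hx : extChartAt I x x ∈ Set.range I := Set.mem_range_self _
  rw [← VectorField.mlieBracketWithin_univ, VectorField.mlieBracketWithin_apply,
    mfderiv_extChartAt_self]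
  simp only [Set.preimage_univ, Set.univ_inter]
  erw [ContinuousLinearMap.inverse_id]
  have e1 (V : (z : M) → TangentSpace I z) :
      fderivWithin ℝ (F := E)
        (VectorField.mpullbackWithin 𝓘(ℝ, E) I (extChartAt I x).symm V (Set.range I))
        (Set.range I) (extChartAt I x x) = chartDeriv I (vectorFieldCoord x V) x :=
    Filter.EventuallyEq.fderivWithin_eq_of_mem (key V) hx
  have e2 (V : (z : M) → TangentSpace I z) :
      VectorField.mpullbackWithin 𝓘(ℝ, E) I (extChartAt I x).symm V (Set.range I)
      (extChartAt I x x) = V x := by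
    rw [(key V).eq_of_nhdsWithin hx, Function.comp_apply, extChartAt_to_inv, vectorFieldCoord_self]
  change fderivWithin ℝ (F := E)
      (VectorField.mpullbackWithin 𝓘(ℝ, E) I (extChartAt I x).symm Y (Set.range I)) (Set.range I)
        (extChartAt I x x) _ -
    fderivWithin ℝ (F := E)
      (VectorField.mpullbackWithin 𝓘(ℝ, E) I (extChartAt I x).symm X (Set.range I)) (Set.range I)
        (extChartAt I x x) _ = _
  rw [e1, e1, e2, e2]

/-- A Riemannian metric read in the preferred trivialization of the tangent bundle at `x`. -/
def metricCoord (G : SmoothRiemannianMetric I M) (x z : M) : E →L[ℝ] E →L[ℝ] ℝ :=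
  (trivializationAt (E →L[ℝ] E →L[ℝ] ℝ)
    (fun z : M => TangentSpace I z →L[ℝ] TangentSpace I z →L[ℝ] ℝ) x
    (TotalSpace.mk' (E →L[ℝ] E →L[ℝ] ℝ)
      (E := fun z : M => TangentSpace I z →L[ℝ] TangentSpace I z →L[ℝ] ℝ) z (G.inner z))).2

theorem mdifferentiableAt_metricCoord (G : SmoothRiemannianMetric I M) (x : M) :
    MDifferentiableAt I 𝓘(ℝ, E →L[ℝ] E →L[ℝ] ℝ) (metricCoord G x) x :=
  ((mdifferentiableAt_totalSpace _ _).1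
    ((G.contMDiff x).mdifferentiableAt (by simp))).2

theorem metricCoord_apply (G : SmoothRiemannianMetric I M) (x : M) {z : M}
    (hz : z ∈ (chartAt H x).source) (u v : E) :
    metricCoord G x z u v = G.inner z
      ((trivializationAt E (fun z : M => TangentSpace I z) x).symm z u)
      ((trivializationAt E (fun z : M => TangentSpace I z) x).symm z v) := by
  rw [metricCoord, hom_trivializationAt_apply]
  rw [inCoordinates_apply_eq₂ hz hz (Set.mem_univ _)]
  simp

theorem metricCoord_vectorFieldCoord (G : SmoothRiemannianMetric I M) (x : M) {z : M}
    (hz : z ∈ (chartAt H x).source) (Y Z : (z : M) → TangentSpace I z) :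
    metricCoord G x z (vectorFieldCoord x Y z) (vectorFieldCoord x Z z)
      = G.inner z (Y z) (Z z) := by
  rw [metricCoord_apply G x hz]
  congr 1
  · congr 1
    exact Trivialization.symm_apply_apply_mk _ hz _
  · exact Trivialization.symm_apply_apply_mk _ hz _

theorem metricCoord_self (G : SmoothRiemannianMetric I M) (x : M) (u v : TangentSpace I x) :
    metricCoord G x x u v = G.inner x u v := by
  classical
  -- The identity for fields is pointwise, so fields supported at the single point `x` are
  -- admissible.
  have := metricCoord_vectorFieldCoord G x (mem_chart_source H x)
    (fun z => if h : z = x then h ▸ u else 0) (fun z => if h : z = x then h ▸ v else 0)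
  simpa [vectorFieldCoord_self] using this

set_option synthInstance.maxHeartbeats 200000 in
/-- The first derivatives of the coefficients of a Riemannian metric in the preferred chart at `x`:
`metricDeriv G x w u v` is the derivative of `G(u, v)` in the direction `w`. -/
def metricDeriv (G : SmoothRiemannianMetric I M) (x : M) : E →L[ℝ] E →L[ℝ] E →L[ℝ] ℝ :=
  chartDeriv I (metricCoord G x) x

theorem metricDeriv_apply (G : SmoothRiemannianMetric I M) (x : M) (w u v : E) :
    metricDeriv G x w u v = chartDeriv I (fun z => metricCoord G x z u v) x w := by
  have hd := mdifferentiableAt_metricCoord G x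
  have h1 : HasFDerivWithinAt ((fun z => metricCoord G x z u v) ∘ (extChartAt I x).symm)
      (((metricDeriv G x).flip u).flip v) (Set.range I) (extChartAt I x x) := by
    have h2 := (hd.hasFDerivWithinAt_chartDeriv.clm_apply
      (hasFDerivWithinAt_const (𝕜 := ℝ) u _ _)).clm_apply (hasFDerivWithinAt_const (𝕜 := ℝ) v _ _)
    simpa [Function.comp_def, metricDeriv] using! h2
  rw [h1.chartDeriv_eq]
  rfl

theorem metricDeriv_symm (G : SmoothRiemannianMetric I M) (x : M) (w u v : E) :
    metricDeriv G x w u v = metricDeriv G x w v u := by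
  have h' : (fun z => metricCoord G x z u v) =ᶠ[𝓝 x] fun z => metricCoord G x z v u := by
    filter_upwards [chart_source_mem_nhds H x] with z hz
    rw [metricCoord_apply G x hz, metricCoord_apply G x hz, G.symm]
  rw [metricDeriv_apply, metricDeriv_apply, h'.chartDeriv_eq]

end Coordinates

/-! ### The Levi-Civita connection from the Koszul formula. -/

section LeviCivita

variable {E : Type*} [NormedAddCommGroup E] [NormedSpace ℝ E]

/-- A positive definite bilinear form on a finite dimensional space represents every bilinear map
into the dual space. -/
theorem exists_clm_of_posDef [FiniteDimensional ℝ E] (B : E →L[ℝ] E →L[ℝ] ℝ)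
    (hB : ∀ v, v ≠ 0 → 0 < B v v) (K : E →L[ℝ] E →L[ℝ] E →L[ℝ] ℝ) :
    ∃ Γ : E →L[ℝ] E →L[ℝ] E, ∀ u v w, B (Γ u v) w = K u v w := by
  have hinj : Function.Injective (B : E →ₗ[ℝ] E →L[ℝ] ℝ) := by
    rw [injective_iff_map_eq_zero]
    intro v hv
    by_contra h
    have h0 : B v = 0 := hv
    simpa [h0] using hB v h
  have hdim : Module.finrank ℝ E = Module.finrank ℝ (E →L[ℝ] ℝ) := by
    rw [← (LinearMap.toContinuousLinearMap (𝕜 := ℝ) (E := E) (F' := ℝ)).finrank_eq]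
    exact (Subspace.dual_finrank_eq (K := ℝ) (V := E)).symm
  let e : E ≃L[ℝ] (E →L[ℝ] ℝ) :=
    ((B : E →ₗ[ℝ] E →L[ℝ] ℝ).linearEquivOfInjective hinj hdim).toContinuousLinearEquiv
  refine ⟨(ContinuousLinearMap.compL ℝ E (E →L[ℝ] ℝ) E
    (e.symm : (E →L[ℝ] ℝ) →L[ℝ] E)).comp K, fun u v w => ?_⟩
  exact congrArg (· w) (e.apply_symm_apply (K u v))

/-- The Koszul expression of the Christoffel symbols. -/
theorem exists_christoffel [FiniteDimensional ℝ E] (B : E →L[ℝ] E →L[ℝ] ℝ)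
    (hB : ∀ v, v ≠ 0 → 0 < B v v) (P : E →L[ℝ] E →L[ℝ] E →L[ℝ] ℝ) :
    ∃ Γ : E →L[ℝ] E →L[ℝ] E, ∀ u v w,
      B (Γ v u) w = (P u v w + P v u w - P w v u) / 2 := by
  -- The Koszul term with the minus sign: the direction of differentiation becomes the last
  -- argument.
  let Q : E →L[ℝ] E →L[ℝ] E →L[ℝ] ℝ :=
    (ContinuousLinearMap.flipₗᵢ ℝ E E ℝ).toContinuousLinearEquiv.toContinuousLinearMap.comp P.flip
  have hQ (v u w : E) : Q v u w = P w v u := rfl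
  obtain ⟨Γ, hΓ⟩ := exists_clm_of_posDef B hB ((1 / 2 : ℝ) • (P.flip + P - Q))
  refine ⟨Γ, fun u v w => ?_⟩
  have h : ((1 / 2 : ℝ) • (P.flip + P - Q)) v u w = (1 / 2 : ℝ) * (P u v w + P v u w - Q v u w) :=
    rfl
  rw [hΓ, h, hQ]
  ring

variable {H : Type*} [TopologicalSpace H] {I : ModelWithCorners ℝ E H}
  {M : Type*} [TopologicalSpace M] [ChartedSpace H M] [IsManifold I ∞ M]

/-- Existence of the Levi-Civita connection, with its expression in the preferred chart at each
point. -/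
theorem exists_leviCivita [FiniteDimensional ℝ E] (G : SmoothRiemannianMetric I M) :
    ∃ D : CovariantDerivative I E (fun y : M => TangentSpace I y), IsLeviCivita G D ∧
      ∀ (Y : (y : M) → TangentSpace I y) (x : M) (u w : E),
        G.inner x (D Y x u) w =
          G.inner x (chartDeriv I (vectorFieldCoord x Y) x u : E) w +
            (metricDeriv G x u (Y x) w
              + metricDeriv G x (Y x) u w
              - metricDeriv G x w (Y x) u) / 2 := by
  have hΓ (x : M) := exists_christoffel (metricCoord G x x)
    (fun v hv => (G.pos x v hv).trans_eq (metricCoord_self G x v v).symm) (metricDeriv G x)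
  choose Γ hΓ using hΓ
  -- The source of torsion-freeness: the Koszul expression is symmetric in `u` and `v` because the
  -- metric is, and nondegeneracy removes the pairing with `w`.
  have hsymm (x : M) (u v : E) : Γ x u v = Γ x v u := by
    by_contra h
    have h1 := G.pos x (Γ x u v - Γ x v u) (sub_ne_zero.2 h)
    have h2 (w : E) : metricCoord G x x (Γ x u v - Γ x v u) w = 0 := by
      rw [map_sub, sub_apply, hΓ, hΓ, metricDeriv_symm G x w u v]
      ring
    exact (h1.trans_eq (metricCoord_self G x _ _).symm).ne' (h2 _)
  -- The source of metric compatibility: adding two Koszul expressions cancels all terms except the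
  -- derivative in the direction `u`.
  have hmetric (x : M) (u v w : E) : metricCoord G x x (Γ x v u) w + metricCoord G x x v (Γ x w u) =
      metricDeriv G x u v w := by
    have hs : metricCoord G x x v (Γ x w u) = metricCoord G x x (Γ x w u) v :=
      (metricCoord_self G x v (Γ x w u)).trans
        ((G.symm x _ _).trans (metricCoord_self G x (Γ x w u) v).symm)
    rw [hs, hΓ, hΓ, metricDeriv_symm G x u w v, metricDeriv_symm G x w v u,
      metricDeriv_symm G x v w u]
    ring
  -- The value at `x` uses the chart centred at `x` only. Additivity and the Leibniz rule are
  -- conditions at one point, so different points need not be compared.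
  let D : CovariantDerivative I E (fun y : M => TangentSpace I y) :=
    { toFun := fun Y x => (chartDeriv I (vectorFieldCoord x Y) x + Γ x (Y x) : E →L[ℝ] E)
      isCovariantDerivativeOnUniv := by
        constructor
        · intro Y Z x hY hZ _
          have h := (vectorFieldCoord_add x Y Z).chartDeriv_eq (I := I)
          rw [chartDeriv_add (mdifferentiableAt_vectorFieldCoord hY)
            (mdifferentiableAt_vectorFieldCoord hZ)] at h
          change (chartDeriv I (vectorFieldCoord x (Y + Z)) x + Γ x (Y x + Z x) : E →L[ℝ] E) =
            (chartDeriv I (vectorFieldCoord x Y) x + Γ x (Y x)) +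
            (chartDeriv I (vectorFieldCoord x Z) x + Γ x (Z x))
          rw [h]
          erw [map_add]
          abel
        · intro Y c x hY hc _
          have h := (vectorFieldCoord_smul x c Y).chartDeriv_eq (I := I)
          rw [chartDeriv_smul hc (mdifferentiableAt_vectorFieldCoord hY),
            vectorFieldCoord_self] at h
          have hm : (mfderiv I 𝓘(ℝ, ℝ) c x : E →L[ℝ] ℝ) = chartDeriv I c x :=
            hc.mfderiv_eq_chartDeriv
          have key (y u : E) : (c x • chartDeriv I (vectorFieldCoord x Y) x +
              (chartDeriv I c x).smulRight y) u + Γ x (c x • y) u =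
                c x • (chartDeriv I (vectorFieldCoord x Y) x u + Γ x y u) +
                  chartDeriv I c x u • y := by
            simp
            abel
          refine ContinuousLinearMap.ext fun u => ?_
          change chartDeriv I (vectorFieldCoord x (c • Y)) x u + Γ x (c x • Y x) u =
            c x • (chartDeriv I (vectorFieldCoord x Y) x u + Γ x (Y x) u) +
              HSMul.hSMul (α := ℝ) (β := E) ((mfderiv I 𝓘(ℝ, ℝ) c x : E →L[ℝ] ℝ) u) (Y x)
          rw [h, hm]
          exact key (Y x) u }
  refine ⟨D, ⟨fun X Y x hX hY => ?_, fun Y Z x hY hZ u => ?_⟩, fun Y x u w => ?_⟩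
  · rw [mlieBracket_eq_chartDeriv]
    change (chartDeriv I (vectorFieldCoord x Y) x (X x) + Γ x (Y x) (X x)) -
      (chartDeriv I (vectorFieldCoord x X) x (Y x) + Γ x (X x) (Y x)) = _
    rw [hsymm x (Y x) (X x)]
    abel
  · have hY' := mdifferentiableAt_vectorFieldCoord hY
    have hZ' := mdifferentiableAt_vectorFieldCoord hZ
    have hG := mdifferentiableAt_metricCoord G x
    have hev : (fun z => G.inner z (Y z) (Z z)) =ᶠ[𝓝 x]
        fun z => metricCoord G x z (vectorFieldCoord x Y z) (vectorFieldCoord x Z z) := by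
      filter_upwards [chart_source_mem_nhds H x] with z hz
      rw [metricCoord_vectorFieldCoord G x hz]
    have hd : MDifferentiableAt I 𝓘(ℝ, ℝ) (fun z =>
        metricCoord G x z (vectorFieldCoord x Y z) (vectorFieldCoord x Z z)) x :=
      (hG.clm_apply hY').clm_apply hZ'
    have h1 : (mfderiv I 𝓘(ℝ, ℝ) (fun z => G.inner z (Y z) (Z z)) x : E →L[ℝ] ℝ) =
        chartDeriv I (fun z =>
          metricCoord G x z (vectorFieldCoord x Y z) (vectorFieldCoord x Z z)) x :=
      hev.mfderiv_eq.trans hd.mfderiv_eq_chartDeriv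
    have key (y z v : E) (hy : vectorFieldCoord x Y x = y) (hz : vectorFieldCoord x Z x = z) :
        chartDeriv I (fun z =>
          metricCoord G x z (vectorFieldCoord x Y z) (vectorFieldCoord x Z z)) x v =
        metricCoord G x x (chartDeriv I (vectorFieldCoord x Y) x v + Γ x y v) z +
          metricCoord G x x y (chartDeriv I (vectorFieldCoord x Z) x v + Γ x z v) := by
      rw [chartDeriv_clm_apply (A := fun z => metricCoord G x z (vectorFieldCoord x Y z))
        (hG.clm_apply hY') hZ', chartDeriv_clm_apply hG hY', hy, hz]
      have h2 := hmetric x v y z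
      change _ = chartDeriv I (metricCoord G x) x v y z at h2
      rw [map_add, map_add, add_apply, add_apply, ← h2]
      ring
    refine (congrArg (· u) h1).trans ?_
    refine (key (Y x) (Z x) u (vectorFieldCoord_self x Y) (vectorFieldCoord_self x Z)).trans ?_
    exact congrArg₂ (· + ·) (metricCoord_self G x _ _) (metricCoord_self G x _ _)
  · refine (metricCoord_self G x _ _).symm.trans ?_
    refine Eq.trans ?_ (congrArg₂ (· + ·) (metricCoord_self G x _ _) (hΓ x u (Y x) w))
    change metricCoord G x x (chartDeriv I (vectorFieldCoord x Y) x u + Γ x (Y x) u) w = _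
    rw [map_add, add_apply]

end LeviCivita

/-! ### Tangent coordinates on `M × ℝ` and smoothness of the `J_a`. -/

section ProductWithLine

variable {E : Type*} [NormedAddCommGroup E] [NormedSpace ℝ E]
  {H : Type*} [TopologicalSpace H] {I : ModelWithCorners ℝ E H}
  {M : Type*} [TopologicalSpace M] [ChartedSpace H M]

theorem mem_chart_source_prod_line {x₀ x : M} (hx : x ∈ (chartAt H x₀).source) (t₀ t : ℝ) :
    (x, t) ∈ (chartAt (ModelProd H ℝ) (x₀, t₀)).source := by
  exact ⟨hx, Set.mem_univ t⟩

/-- The endomorphism `(X, r) ↦ (φ X + r ξ, -η X)` of `E × ℝ`. -/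
def productEndomorphism (φ : E →L[ℝ] E) (ξ : E) (η : E →L[ℝ] ℝ) : E × ℝ →L[ℝ] E × ℝ :=
  (ContinuousLinearMap.inl ℝ E ℝ).comp (φ.comp (ContinuousLinearMap.fst ℝ E ℝ)) +
    (ContinuousLinearMap.snd ℝ E ℝ).smulRight (ContinuousLinearMap.inl ℝ E ℝ ξ) -
    (ContinuousLinearMap.inr ℝ E ℝ).comp (η.comp (ContinuousLinearMap.fst ℝ E ℝ))

@[simp]
theorem productEndomorphism_apply (φ : E →L[ℝ] E) (ξ : E) (η : E →L[ℝ] ℝ) (p : E × ℝ) :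
    productEndomorphism φ ξ η p = (φ p.1 + p.2 • ξ, -η p.1) := by
  simp [productEndomorphism]

theorem contMDiffAt_productEndomorphism {Φ : M → E →L[ℝ] E} {Ξ : M → E} {Η : M → E →L[ℝ] ℝ} {x₀ : M}
    (h1 : ContMDiffAt I 𝓘(ℝ, E →L[ℝ] E) ∞ Φ x₀) (h2 : ContMDiffAt I 𝓘(ℝ, E) ∞ Ξ x₀)
    (h3 : ContMDiffAt I 𝓘(ℝ, E →L[ℝ] ℝ) ∞ Η x₀) (t₀ : ℝ) :
    ContMDiffAt (I.prod 𝓘(ℝ, ℝ)) 𝓘(ℝ, E × ℝ →L[ℝ] E × ℝ) ∞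
      (fun p : M × ℝ => productEndomorphism (Φ p.1) (Ξ p.1) (Η p.1)) (x₀, t₀) := by
  have hfst : ContMDiffAt (I.prod 𝓘(ℝ, ℝ)) I ∞ (Prod.fst : M × ℝ → M) (x₀, t₀) := contMDiffAt_fst
  unfold productEndomorphism
  refine ContMDiffAt.sub (ContMDiffAt.add ?_ ?_) ?_
  · exact contMDiffAt_const.clm_comp ((h1.comp (x₀, t₀) hfst).clm_comp contMDiffAt_const)
  -- The term `(X, r) ↦ (r ξ, 0)` depends on `ξ` through a fixed continuous linear map.
  · exact (contMDiffAt_const (c := ((ContinuousLinearMap.smulRightL ℝ (E × ℝ) (E × ℝ)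
      (ContinuousLinearMap.snd ℝ E ℝ)).comp (ContinuousLinearMap.inl ℝ E ℝ)))).clm_apply
      (h2.comp (x₀, t₀) hfst)
  · exact contMDiffAt_const.clm_comp ((h3.comp (x₀, t₀) hfst).clm_comp contMDiffAt_const)

variable [IsManifold I ∞ M]

/-- The chart of `M × ℝ` at `(x₀, t₀)` is the chart of `M` times the identity, so its differential
is a product with the identity on the line. -/
theorem trivializationAt_prod_line {x₀ x : M} (hx : x ∈ (chartAt H x₀).source) (t₀ t : ℝ)
    (v : TangentSpace I x) (r : ℝ) :
    (trivializationAt (E × ℝ) (fun p : M × ℝ => TangentSpace (I.prod 𝓘(ℝ, ℝ)) p) (x₀, t₀)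
      (TotalSpace.mk' (E × ℝ) (E := fun p : M × ℝ => TangentSpace (I.prod 𝓘(ℝ, ℝ)) p)
        (x, t) (v, r))).2 =
      ((trivializationAt E (fun x : M => TangentSpace I x) x₀
        (TotalSpace.mk' E (E := fun x : M => TangentSpace I x) x v)).2, r) := by
  refine (trivializationAt_snd_eq_mfderiv (I := I.prod 𝓘(ℝ, ℝ)) (x₀, t₀)
    (mem_chart_source_prod_line hx t₀ t) (v, r)).trans ?_
  refine Eq.trans ?_ (congrArg (Prod.mk · r) (trivializationAt_snd_eq_mfderiv x₀ hx v).symm)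
  have hc : MDifferentiableAt I 𝓘(ℝ, E) (extChartAt I x₀) x := mdifferentiableAt_extChartAt hx
  have key : mfderiv (I.prod 𝓘(ℝ, ℝ)) 𝓘(ℝ, E × ℝ) (extChartAt (I.prod 𝓘(ℝ, ℝ)) (x₀, t₀)) (x, t) =
      (mfderiv I 𝓘(ℝ, E) (extChartAt I x₀) x).prodMap (mfderiv 𝓘(ℝ, ℝ) 𝓘(ℝ, ℝ) id t) := by
    rw [← mfderiv_prodMap (p := (x, t)) hc mdifferentiableAt_id, extChartAt_prod,
      modelWithCornersSelf_prod, ← chartedSpaceSelf_prod]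
    rfl
  refine (congrArg (fun L : E × ℝ →L[ℝ] E × ℝ => L (v, r)) key).trans ?_
  rw [mfderiv_id]
  rfl

theorem trivializationAt_symm_prod_line {x₀ x : M} (hx : x ∈ (chartAt H x₀).source) (t₀ t : ℝ)
    (v : E) (r : ℝ) :
    (trivializationAt (E × ℝ) (fun p : M × ℝ => TangentSpace (I.prod 𝓘(ℝ, ℝ)) p) (x₀, t₀)).symm
      (x, t) (v, r) =
      ((trivializationAt E (fun x : M => TangentSpace I x) x₀).symm x v, r) := by
  have h := trivializationAt_prod_line hx t₀ t
    ((trivializationAt E (fun x : M => TangentSpace I x) x₀).symm x v) r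
  have h1 : (trivializationAt E (fun x : M => TangentSpace I x) x₀
      (TotalSpace.mk' E (E := fun x : M => TangentSpace I x) x
        ((trivializationAt E (fun x : M => TangentSpace I x) x₀).symm x v))).2 = v :=
    congrArg Prod.snd (Trivialization.apply_mk_symm _ hx v)
  rw [h1] at h
  refine (congrArg _ h.symm).trans ?_
  exact Trivialization.symm_apply_apply_mk _ (mem_chart_source_prod_line hx t₀ t) _

theorem inCoordinates_endomorphism_apply {x₀ x : M} (hx : x ∈ (chartAt H x₀).source)
    (A : TangentSpace I x →L[ℝ] TangentSpace I x) (v : E) :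
    ContinuousLinearMap.inCoordinates E (fun x : M => TangentSpace I x) E
      (fun x : M => TangentSpace I x) x₀ x x₀ x A v =
      (trivializationAt E (fun x : M => TangentSpace I x) x₀
        (TotalSpace.mk' E (E := fun x : M => TangentSpace I x) x
          (A ((trivializationAt E (fun x : M => TangentSpace I x) x₀).symm x v)))).2 := by
  rw [ContinuousLinearMap.inCoordinates_eq hx hx]
  rfl

theorem inCoordinates_form_apply {x₀ x : M} (hx : x ∈ (chartAt H x₀).source)
    (A : TangentSpace I x →L[ℝ] ℝ) (v : E) :
    ContinuousLinearMap.inCoordinates E (fun x : M => TangentSpace I x) ℝ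
      (fun _ : M => ℝ) x₀ x x₀ x A v =
      A ((trivializationAt E (fun x : M => TangentSpace I x) x₀).symm x v) := by
  rw [ContinuousLinearMap.inCoordinates_eq hx (Set.mem_univ _)]
  rfl

/-- Coordinates commute with the construction of `J_a`, which reduces its smoothness to that of the
coordinates of `φ`, `ξ` and `η`. -/
theorem inCoordinates_productEndomorphism {x₀ x : M} (hx : x ∈ (chartAt H x₀).source) (t₀ t : ℝ)
    (φ : TangentSpace I x →L[ℝ] TangentSpace I x) (ξ : TangentSpace I x)
    (η : TangentSpace I x →L[ℝ] ℝ) :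
    ContinuousLinearMap.inCoordinates (E × ℝ) (fun p : M × ℝ => TangentSpace (I.prod 𝓘(ℝ, ℝ)) p)
      (E × ℝ) (fun p : M × ℝ => TangentSpace (I.prod 𝓘(ℝ, ℝ)) p) (x₀, t₀) (x, t) (x₀, t₀) (x, t)
      (productEndomorphism (φ : E →L[ℝ] E) (ξ : E) (η : E →L[ℝ] ℝ)) =
    productEndomorphism
      (ContinuousLinearMap.inCoordinates E (fun x : M => TangentSpace I x) E
        (fun x : M => TangentSpace I x) x₀ x x₀ x φ)
      (trivializationAt E (fun x : M => TangentSpace I x) x₀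
        (TotalSpace.mk' E (E := fun x : M => TangentSpace I x) x ξ)).2
      (ContinuousLinearMap.inCoordinates E (fun x : M => TangentSpace I x) ℝ
        (fun _ : M => ℝ) x₀ x x₀ x η) := by
  refine ContinuousLinearMap.ext fun ⟨v, r⟩ => ?_
  refine (inCoordinates_endomorphism_apply (mem_chart_source_prod_line hx t₀ t) _ (v, r)).trans ?_
  rw [trivializationAt_symm_prod_line hx, productEndomorphism_apply, inCoordinates_form_apply hx,
    inCoordinates_endomorphism_apply hx, trivializationAt_snd_eq_mfderiv x₀ hx,
    trivializationAt_snd_eq_mfderiv x₀ hx]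
  set w : TangentSpace I x := (trivializationAt E (fun x : M => TangentSpace I x) x₀).symm x v
  have h1 : productEndomorphism (E := E) φ ξ η ((w, r) : E × ℝ) =
      ((φ w + r • ξ : TangentSpace I x), -η w) :=
    productEndomorphism_apply (E := E) φ ξ η ((w, r) : E × ℝ)
  refine (congrArg (fun q : E × ℝ =>
    (trivializationAt (E × ℝ) (fun p : M × ℝ => TangentSpace (I.prod 𝓘(ℝ, ℝ)) p) (x₀, t₀)
      (TotalSpace.mk' (E × ℝ) (E := fun p : M × ℝ => TangentSpace (I.prod 𝓘(ℝ, ℝ)) p)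
        (x, t) q)).2) h1).trans ?_
  refine (trivializationAt_prod_line hx t₀ t _ _).trans ?_
  rw [trivializationAt_snd_eq_mfderiv x₀ hx, map_add, map_smul]
  rfl

/-- The field of endomorphisms `(X, r) ↦ (φ X + r ξ, -η X)` of `M × ℝ` is smooth. -/
theorem AlmostCocomplexStructure.contMDiff_productEndomorphism
    (S : AlmostCocomplexStructure I M) :
    ContMDiff (I.prod 𝓘(ℝ, ℝ)) ((I.prod 𝓘(ℝ, ℝ)).prod 𝓘(ℝ, E × ℝ →L[ℝ] E × ℝ)) ∞
      (fun p : M × ℝ => TotalSpace.mk' (E × ℝ →L[ℝ] E × ℝ)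
        (E := fun p : M × ℝ => TangentSpace (I.prod 𝓘(ℝ, ℝ)) p →L[ℝ]
          TangentSpace (I.prod 𝓘(ℝ, ℝ)) p) p
        (productEndomorphism (S.φ p.1 : E →L[ℝ] E) (S.ξ p.1 : E) (S.η p.1 : E →L[ℝ] ℝ))) := by
  rintro ⟨x₀, t₀⟩
  have h1 := ((contMDiffAt_hom_bundle _).1 (S.smooth_φ x₀)).2
  have h2 := (contMDiffAt_totalSpace.1 (S.smooth_ξ x₀)).2
  have h3 := ((contMDiffAt_hom_bundle _).1 (S.smooth_η x₀)).2
  have h4 := contMDiffAt_productEndomorphism h1 h2 h3 t₀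
  refine (contMDiffAt_hom_bundle _).2 ⟨contMDiffAt_id, h4.congr_of_eventuallyEq ?_⟩
  filter_upwards [chart_source_mem_nhds (ModelProd H ℝ) (x₀, t₀)] with p hp
  exact inCoordinates_productEndomorphism hp.1 t₀ p.2 _ _ _

end ProductWithLine

/-! ### The Hermitian metrics `f(t) (g + dt²)` and the quaternion relations. -/

section WarpedMetric

variable {E : Type*} [NormedAddCommGroup E] [NormedSpace ℝ E]
  {H : Type*} [TopologicalSpace H] {I : ModelWithCorners ℝ E H}
  {M : Type*} [TopologicalSpace M] [ChartedSpace H M]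

/-- The bilinear form `c (A(X, Y) + r s)` on `E × ℝ`. -/
def productForm (c : ℝ) (A : E →L[ℝ] E →L[ℝ] ℝ) : E × ℝ →L[ℝ] E × ℝ →L[ℝ] ℝ :=
  c • (((ContinuousLinearMap.compL ℝ (E × ℝ) E ℝ).flip (ContinuousLinearMap.fst ℝ E ℝ)).comp
      (A.comp (ContinuousLinearMap.fst ℝ E ℝ)) +
    (ContinuousLinearMap.snd ℝ E ℝ).smulRight (ContinuousLinearMap.snd ℝ E ℝ))

@[simp]
theorem productForm_apply (c : ℝ) (A : E →L[ℝ] E →L[ℝ] ℝ) (p q : E × ℝ) :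
    productForm c A p q = c * (A p.1 q.1 + p.2 * q.2) := by
  rfl

set_option synthInstance.maxHeartbeats 400000 in
theorem contMDiffAt_productForm {c : ℝ → ℝ} (hc : ContDiff ℝ ∞ c)
    {A : M → E →L[ℝ] E →L[ℝ] ℝ} {x₀ : M}
    (hA : ContMDiffAt I 𝓘(ℝ, E →L[ℝ] E →L[ℝ] ℝ) ∞ A x₀) (t₀ : ℝ) :
    ContMDiffAt (I.prod 𝓘(ℝ, ℝ)) 𝓘(ℝ, E × ℝ →L[ℝ] E × ℝ →L[ℝ] ℝ) ∞
      (fun p : M × ℝ => productForm (c p.2) (A p.1)) (x₀, t₀) := by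
  have hfst : ContMDiffAt (I.prod 𝓘(ℝ, ℝ)) I ∞ (Prod.fst : M × ℝ → M) (x₀, t₀) := contMDiffAt_fst
  have hsnd : ContMDiffAt (I.prod 𝓘(ℝ, ℝ)) 𝓘(ℝ, ℝ) ∞ (Prod.snd : M × ℝ → ℝ) (x₀, t₀) :=
    contMDiffAt_snd
  unfold productForm
  refine ContMDiffAt.smul (hc.contMDiff.contMDiffAt.comp (x₀, t₀) hsnd) ?_
  have h := (contMDiffAt_const (I := I.prod 𝓘(ℝ, ℝ)) (x := (x₀, t₀)) (n := ∞)
    (c := (ContinuousLinearMap.compL ℝ (E × ℝ) E ℝ).flip (ContinuousLinearMap.fst ℝ E ℝ))).clm_comp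
    ((hA.comp (x₀, t₀) hfst).clm_comp
      (contMDiffAt_const (c := ContinuousLinearMap.fst ℝ E ℝ)))
  exact h.add contMDiffAt_const

/-- Both summands are nonnegative, so each is below `1`. Scaling by `√c` puts the `E`-component in
the unit ball of `A` and the line component in `[-1, 1]`. -/
theorem isVonNBounded_productForm {c : ℝ} (hc : 0 < c) {A : E →L[ℝ] E →L[ℝ] ℝ}
    (hA : ∀ v, v ≠ 0 → 0 < A v v) (hb : Bornology.IsVonNBounded ℝ {v : E | A v v < 1}) :
    Bornology.IsVonNBounded ℝ {p : E × ℝ | productForm c A p p < 1} := by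
  have hA' (v : E) : 0 ≤ A v v := by
    by_cases h : v = 0
    · simp [h]
    · exact (hA v h).le
  rw [NormedSpace.isVonNBounded_iff, isBounded_iff_forall_norm_le] at hb ⊢
  obtain ⟨R, hR⟩ := hb
  have hs : 0 < √c := Real.sqrt_pos.2 hc
  have hs2 : √c * √c = c := Real.mul_self_sqrt hc.le
  refine ⟨max R 1 / √c, fun p hp => ?_⟩
  have hp' : c * (A p.1 p.1 + p.2 * p.2) < 1 := hp
  have h0 := mul_nonneg hc.le (hA' p.1)
  have h1 := mul_nonneg hc.le (mul_self_nonneg p.2)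
  have hp1 : ‖√c • p.1‖ ≤ R := by
    apply hR
    simp only [Set.mem_ofPred_eq, map_smul, smul_apply, smul_eq_mul]
    rw [← mul_assoc, hs2]
    linarith
  rw [norm_smul, Real.norm_of_nonneg hs.le] at hp1
  have hp2 : √c * ‖p.2‖ ≤ 1 := by
    rw [← Real.norm_of_nonneg hs.le, ← norm_mul, Real.norm_eq_abs, ← sq_le_one_iff_abs_le_one]
    nlinarith
  rw [le_div_iff₀ hs, mul_comm, Prod.norm_def, mul_max_of_nonneg _ _ hs.le]
  exact max_le_max hp1 hp2

theorem productEndomorphism_sq {φ : E →L[ℝ] E} {ξ : E} {η : E →L[ℝ] ℝ}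
    (h1 : ∀ X, φ (φ X) = -X + η X • ξ) (h2 : φ ξ = 0) (h3 : ∀ X, η (φ X) = 0) (h4 : η ξ = 1)
    (p : E × ℝ) :
    productEndomorphism φ ξ η (productEndomorphism φ ξ η p) = -p := by
  refine Prod.ext ?_ ?_
  · simp [h1, h2]
  · simp [h3, h4]

/-- The inner map has line component `-η' X`, which the outer map turns into `-η' X • ξ`, the very
correction in the relation for `φ ∘ φ'`. -/
theorem productEndomorphism_comp {φ φ' φ'' : E →L[ℝ] E} {ξ ξ' ξ'' : E} {η η' η'' : E →L[ℝ] ℝ}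
    (h1 : ∀ X, φ (φ' X) - η' X • ξ = φ'' X) (h2 : φ ξ' = ξ'') (h3 : ∀ X, η (φ' X) = η'' X)
    (h4 : η ξ' = 0) (p : E × ℝ) :
    productEndomorphism φ ξ η (productEndomorphism φ' ξ' η' p) =
      productEndomorphism φ'' ξ'' η'' p := by
  refine Prod.ext ?_ ?_
  · simp [← h1, h2]
    abel
  · simp [h3, h4]

theorem productEndomorphism_comp_eq_neg {φ φ' φ'' : E →L[ℝ] E} {ξ ξ' ξ'' : E}
    {η η' η'' : E →L[ℝ] ℝ}
    (h1 : ∀ X, -φ (φ' X) + η' X • ξ = φ'' X) (h2 : -φ ξ' = ξ'') (h3 : ∀ X, -η (φ' X) = η'' X)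
    (h4 : η ξ' = 0) (p : E × ℝ) :
    productEndomorphism φ ξ η (productEndomorphism φ' ξ' η' p) =
      -productEndomorphism φ'' ξ'' η'' p := by
  refine Prod.ext ?_ ?_
  · simp [← h1, ← h2]
    abel
  · simp [← h3, h4]

/-- As `ξ` is a unit vector orthogonal to the image of `φ`, the loss `-η X * η Y` in the
`E`-component is made up by the product of the new line components. -/
theorem productForm_productEndomorphism {c : ℝ} {A : E →L[ℝ] E →L[ℝ] ℝ} {φ : E →L[ℝ] E} {ξ : E}
    {η : E →L[ℝ] ℝ} (hsymm : ∀ X Y, A X Y = A Y X) (hη : ∀ X, η X = A ξ X)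
    (hφ : ∀ X Y, A (φ X) (φ Y) = A X Y - η X * η Y) (hηφ : ∀ X, η (φ X) = 0) (hηξ : η ξ = 1)
    (p q : E × ℝ) :
    productForm c A (productEndomorphism φ ξ η p) (productEndomorphism φ ξ η q) =
      productForm c A p q := by
  have h1 (X : E) : A ξ (φ X) = 0 := by rw [← hη, hηφ]
  have h2 (X : E) : A (φ X) ξ = 0 := by rw [hsymm, h1]
  have h3 : A ξ ξ = 1 := by rw [← hη, hηξ]
  simp only [productEndomorphism_apply, productForm_apply, map_add, map_smul, add_apply, smul_apply,
    smul_eq_mul, h1, h2, h3, hφ]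
  ring

variable [IsManifold I ∞ M]

theorem inCoordinates_productForm {x₀ x : M} (hx : x ∈ (chartAt H x₀).source) (t₀ t c : ℝ)
    (A : TangentSpace I x →L[ℝ] TangentSpace I x →L[ℝ] ℝ) :
    ContinuousLinearMap.inCoordinates (E × ℝ) (fun p : M × ℝ => TangentSpace (I.prod 𝓘(ℝ, ℝ)) p)
      (E × ℝ →L[ℝ] ℝ) (fun p : M × ℝ => TangentSpace (I.prod 𝓘(ℝ, ℝ)) p →L[ℝ] ℝ)
      (x₀, t₀) (x, t) (x₀, t₀) (x, t) (productForm (E := E) c A) =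
    productForm c
      (ContinuousLinearMap.inCoordinates E (fun x : M => TangentSpace I x) (E →L[ℝ] ℝ)
        (fun x : M => TangentSpace I x →L[ℝ] ℝ) x₀ x x₀ x A) := by
  refine ContinuousLinearMap.ext fun ⟨v, r⟩ => ContinuousLinearMap.ext fun ⟨w, s⟩ => ?_
  have hp := mem_chart_source_prod_line hx t₀ t
  refine (inCoordinates_apply_eq₂ hp hp (Set.mem_univ _)).trans ?_
  rw [trivializationAt_symm_prod_line hx, trivializationAt_symm_prod_line hx, productForm_apply,
    inCoordinates_apply_eq₂ hx hx (Set.mem_univ _)]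
  simp
  rfl

/-- The metric `f(t) (g + dt²)` on `M × ℝ`. -/
def SmoothRiemannianMetric.prodLine (g : SmoothRiemannianMetric I M) (f : ℝ → ℝ)
    (hf : ContDiff ℝ ∞ f) (hpos : ∀ t, 0 < f t) :
    SmoothRiemannianMetric (I.prod 𝓘(ℝ, ℝ)) (M × ℝ) where
  inner p := productForm (E := E) (f p.2) (g.inner p.1)
  symm p v w := by
    change f p.2 * (g.inner p.1 v.1 w.1 + v.2 * w.2) = f p.2 * (g.inner p.1 w.1 v.1 + w.2 * v.2)
    rw [g.symm p.1 v.1 w.1, mul_comm v.2]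
  pos p v hv := by
    change 0 < f p.2 * (g.inner p.1 v.1 v.1 + v.2 * v.2)
    refine mul_pos (hpos _) ?_
    by_cases h : v.1 = 0
    · have h2 : v.2 ≠ 0 := fun h2 => hv (Prod.ext h h2)
      have h3 (w : TangentSpace I p.1) (hw : w = 0) : g.inner p.1 w w = 0 := by rw [hw]; simp
      exact add_pos_of_nonneg_of_pos (h3 v.1 h).ge (mul_self_pos.2 h2)
    · exact add_pos_of_pos_of_nonneg (g.pos p.1 v.1 h) (mul_self_nonneg _)
  isVonNBounded p :=
    isVonNBounded_productForm (E := E) (A := g.inner p.1) (hpos p.2) (g.pos p.1)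
      (g.isVonNBounded p.1)
  contMDiff := by
    rintro ⟨x₀, t₀⟩
    have h1 := ((contMDiffAt_hom_bundle _).1 (g.contMDiff x₀)).2
    have h2 := contMDiffAt_productForm hf h1 t₀
    refine (contMDiffAt_hom_bundle _).2 ⟨contMDiffAt_id, h2.congr_of_eventuallyEq ?_⟩
    filter_upwards [chart_source_mem_nhds (ModelProd H ℝ) (x₀, t₀)] with p hp
    exact inCoordinates_productForm hp.1 t₀ p.2 _ _

theorem SmoothRiemannianMetric.prodLine_inner (g : SmoothRiemannianMetric I M) (f : ℝ → ℝ)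
    (hf : ContDiff ℝ ∞ f) (hpos : ∀ t, 0 < f t) (x : M) (t : ℝ) (X Y : TangentSpace I x)
    (r s : ℝ) :
    (g.prodLine f hf hpos).inner (x, t) (X, r) (Y, s) = f t * (g.inner x X Y + r * s) :=
  rfl

/-- Since `φ² ξ = 0`, the formula for `φ²` at `φ ξ` gives `φ ξ = c ξ` with `c = η(φ ξ)`. Then `c • φ
ξ = φ² ξ = 0`, and applying `η` yields `c² = 0`. -/
theorem AlmostCocomplexStructure.φ_ξ (S : AlmostCocomplexStructure I M) (x : M) :
    S.φ x (S.ξ x) = 0 := by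
  have h1 : S.φ x (S.φ x (S.ξ x)) = 0 := by
    rw [S.φ_φ, S.η_ξ, one_smul, neg_add_cancel]
  have h2 : S.φ x (S.ξ x) = S.η x (S.φ x (S.ξ x)) • S.ξ x := by
    have h := S.φ_φ x (S.φ x (S.ξ x))
    rw [h1, map_zero] at h
    exact (neg_add_eq_zero.1 h.symm)
  have h3 : S.η x (S.φ x (S.ξ x)) = 0 := by
    rw [h2, map_smul] at h1
    have h4 := congrArg (S.η x) h1
    rw [map_smul, map_zero] at h4
    have h5 := congrArg (S.η x) h2
    rw [map_smul, S.η_ξ] at h5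
    simpa using h4
  rw [h2, h3, zero_smul]

/-- Computing `φ³ X` as `φ²(φ X)` and as `φ(φ² X)`, with `φ ξ = 0`, leaves `η(φ X) • ξ = 0`. -/
theorem AlmostCocomplexStructure.η_φ (S : AlmostCocomplexStructure I M) (x : M)
    (X : TangentSpace I x) : S.η x (S.φ x X) = 0 := by
  have h := S.φ_φ x (S.φ x X)
  rw [S.φ_φ x X, map_add, map_neg, map_smul, S.φ_ξ, smul_zero, add_zero, left_eq_add] at h
  have h' := congrArg (S.η x) h
  rwa [map_smul, S.η_ξ, map_zero, smul_eq_mul, mul_one] at h'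

/-- `J_a (X, r) = (φ_a X + r ξ_a, -η_a X)` with the metric `f(t) (g + dt²)`. -/
def AlmostCoquaternionMetricStructure.prodLine (S : AlmostCoquaternionMetricStructure I M)
    (f : ℝ → ℝ) (hf : ContDiff ℝ ∞ f) (hpos : ∀ t, 0 < f t) :
    AlmostQuaternionHermitianStructure (I.prod 𝓘(ℝ, ℝ)) (M × ℝ) where
  J a p := productEndomorphism (E := E) ((S.str a).φ p.1) ((S.str a).ξ p.1) ((S.str a).η p.1)
  smooth_J a := (S.str a).contMDiff_productEndomorphism
  J_J a p X := productEndomorphism_sq (E := E) ((S.str a).φ_φ p.1) ((S.str a).φ_ξ p.1)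
    ((S.str a).η_φ p.1) ((S.str a).η_ξ p.1) X
  J_comp a p X := productEndomorphism_comp (E := E) (S.φ_comp a p.1) (S.φ_ξ a p.1) (S.η_φ a p.1)
    (S.η_ξ a p.1) X
  J_comp' a p X := productEndomorphism_comp_eq_neg (E := E) (S.φ_comp' a p.1) (S.φ_ξ' a p.1)
    (S.η_φ' a p.1) (S.η_ξ' a p.1) X
  G := S.g.prodLine f hf hpos
  G_J a p X Y :=
    productForm_productEndomorphism (E := E) (A := S.g.inner p.1) (S.g.symm p.1)
      (S.η_eq a p.1) (S.g_φ a p.1) ((S.str a).η_φ p.1) ((S.str a).η_ξ p.1) X Y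

end WarpedMetric

/-! ### Slices as hypersurfaces and their second fundamental form. -/

section Slices

variable {E : Type*} [NormedAddCommGroup E] [NormedSpace ℝ E]
  {H : Type*} [TopologicalSpace H] {I : ModelWithCorners ℝ E H}
  {M : Type*} [TopologicalSpace M] [ChartedSpace H M]

/-- The unit field `∂/∂t` along the slice `M × {t₀}`. -/
def sliceNormal (I : ModelWithCorners ℝ E H) (t₀ : ℝ) (p : M) :
    TangentSpace (I.prod 𝓘(ℝ, ℝ)) (p, t₀) :=
  ((0 : E), (1 : ℝ))

theorem mfderiv_slice (t₀ : ℝ) (p : M) (u : TangentSpace I p) :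
    mfderiv I (I.prod 𝓘(ℝ, ℝ)) (fun p : M => (p, t₀)) p u = ((u, 0) : E × ℝ) := by
  rw [mfderiv_prod_left]
  rfl

variable [IsManifold I ∞ M]

/-- The slices `M × {t₀}` are smoothly embedded. -/
theorem isSmoothEmbedding_slice (t₀ : ℝ) :
    Manifold.IsSmoothEmbedding I (I.prod 𝓘(ℝ, ℝ)) ∞ (fun p : M => (p, t₀)) := by
  refine ⟨?_, isEmbedding_prodMkLeft t₀⟩
  -- The normal form `e ↦ (e, 0)` of an immersion needs a chart of the line that sends `t₀` to `0`.
  have hshift : (Homeomorph.addRight (-t₀)).toOpenPartialHomeomorph ∈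
      IsManifold.maximalAtlas 𝓘(ℝ, ℝ) ∞ ℝ := by
    refine StructureGroupoid.mem_maximalAtlas_of_mem_groupoid _
      (mem_groupoid_of_pregroupoid.2 ⟨?_, ?_⟩)
    · change ContDiffOn ℝ ∞ (fun t : ℝ => t + -t₀) _
      fun_prop
    · change ContDiffOn ℝ ∞ (fun t : ℝ => t + - -t₀) _
      fun_prop
  have h : Manifold.IsImmersionOfComplement ℝ I (I.prod 𝓘(ℝ, ℝ)) ∞ (fun p : M => (p, t₀)) := by
    intro x
    refine Manifold.IsImmersionAtOfComplement.mk_of_continuousAt (by fun_prop)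
      (ContinuousLinearEquiv.refl ℝ (E × ℝ)) (chartAt H x)
      ((chartAt H x).prod (Homeomorph.addRight (-t₀)).toOpenPartialHomeomorph)
      (mem_chart_source H x) ⟨mem_chart_source H x, Set.mem_univ _⟩
      (IsManifold.chart_mem_maximalAtlas x)
      (IsManifold.mem_maximalAtlas_prod (IsManifold.chart_mem_maximalAtlas x) hshift) ?_
    intro e he
    refine Prod.ext ?_ ?_
    · exact ((chartAt H x).extend I).right_inv he
    · change t₀ + -t₀ = 0
      ring
  exact h.isImmersion

/-- In product trivializations the field has the constant coordinates `(0, 1)`. -/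
theorem contMDiff_sliceNormal (t₀ : ℝ) :
    ContMDiff I ((I.prod 𝓘(ℝ, ℝ)).prod 𝓘(ℝ, E × ℝ)) ∞
      (fun p : M => TotalSpace.mk' (E × ℝ)
        (E := fun y : M × ℝ => TangentSpace (I.prod 𝓘(ℝ, ℝ)) y) (p, t₀) (sliceNormal I t₀ p)) := by
  intro x₀
  refine contMDiffAt_totalSpace.2 ⟨contMDiffAt_id.prodMk contMDiffAt_const, ?_⟩
  refine (contMDiffAt_const (c := ((0 : E), (1 : ℝ)))).congr_of_eventuallyEq ?_
  filter_upwards [chart_source_mem_nhds H x₀] with x hx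
  refine (trivializationAt_prod_line hx t₀ t₀ (0 : TangentSpace I x) 1).trans ?_
  refine congrArg (Prod.mk · (1 : ℝ)) ?_
  rw [trivializationAt_snd_eq_mfderiv x₀ hx]
  exact map_zero _

theorem isHypersurfaceWithUnitNormal_slice [FiniteDimensional ℝ E] (g : SmoothRiemannianMetric I M)
    {f : ℝ → ℝ} (hf : ContDiff ℝ ∞ f) (hpos : ∀ t, 0 < f t) {t₀ : ℝ} (ht₀ : f t₀ = 1) :
    IsHypersurfaceWithUnitNormal I (g.prodLine f hf hpos) (fun p : M => (p, t₀))
      (sliceNormal I t₀) where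
  codim_one := by simp
  embedding := isSmoothEmbedding_slice t₀
  smooth := contMDiff_sliceNormal t₀
  unit p := by
    refine (g.prodLine_inner f hf hpos p t₀ 0 0 1 1).trans ?_
    simp [ht₀]
  normal p u := by
    rw [mfderiv_slice]
    refine (g.prodLine_inner f hf hpos p t₀ 0 u 1 0).trans ?_
    simp

/-- The conditions on `J_a` are its values on `(X, 0)` and `(0, 1)`; the factor `f` enters only the
induced metric, whence `f t₀ = 1`. -/
theorem inducesStructure_slice (S : AlmostCoquaternionMetricStructure I M)
    {f : ℝ → ℝ} (hf : ContDiff ℝ ∞ f) (hpos : ∀ t, 0 < f t) {t₀ : ℝ} (ht₀ : f t₀ = 1) :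
    InducesStructure (S.prodLine f hf hpos) (fun p : M => (p, t₀)) (sliceNormal I t₀) S where
  J_tangent a p X := by
    rw [mfderiv_slice, mfderiv_slice]
    refine (productEndomorphism_apply (E := E) _ _ _ ((X, 0) : E × ℝ)).trans ?_
    refine Prod.ext ?_ ?_
    · change (S.str a).φ p X + (0 : ℝ) • (S.str a).ξ p =
        (S.str a).φ p X - (S.str a).η p X • (0 : TangentSpace I p)
      simp
    · change -(S.str a).η p X = 0 - (S.str a).η p X * 1
      ring
  J_normal a p := by
    rw [mfderiv_slice]
    refine (productEndomorphism_apply (E := E) _ _ _ ((0, 1) : E × ℝ)).trans ?_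
    refine Prod.ext ?_ ?_
    · change (S.str a).φ p 0 + (1 : ℝ) • (S.str a).ξ p = (S.str a).ξ p
      simp
    · change -(S.str a).η p 0 = 0
      simp
  metric p X Y := by
    rw [mfderiv_slice, mfderiv_slice]
    refine (S.g.prodLine_inner f hf hpos p t₀ X Y 0 0).trans ?_
    simp [ht₀]

theorem metricCoord_prodLine (g : SmoothRiemannianMetric I M) {f : ℝ → ℝ} (hf : ContDiff ℝ ∞ f)
    (hpos : ∀ t, 0 < f t) {x₀ x : M} (hx : x ∈ (chartAt H x₀).source) (t₀ t : ℝ) (v w : E × ℝ) :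
    metricCoord (g.prodLine f hf hpos) (x₀, t₀) (x, t) v w =
      f t * (metricCoord g x₀ x v.1 w.1 + v.2 * w.2) := by
  obtain ⟨v, r⟩ := v
  obtain ⟨w, s⟩ := w
  rw [metricCoord_apply _ _ (mem_chart_source_prod_line hx t₀ t), metricCoord_apply g x₀ hx,
    trivializationAt_symm_prod_line hx, trivializationAt_symm_prod_line hx]
  exact g.prodLine_inner f hf hpos x t _ _ r s

/-- The mixed coefficients vanish on a whole neighbourhood, hence so do their derivatives in every
direction. -/
theorem metricDeriv_prodLine_normal (g : SmoothRiemannianMetric I M) {f : ℝ → ℝ}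
    (hf : ContDiff ℝ ∞ f) (hpos : ∀ t, 0 < f t) (x : M) (t : ℝ) (w : E × ℝ) (v : E) :
    metricDeriv (g.prodLine f hf hpos) (x, t) w (v, 0) (0, 1) = 0 := by
  rw [metricDeriv_apply]
  have h : (fun z => metricCoord (g.prodLine f hf hpos) (x, t) z (v, 0) (0, 1)) =ᶠ[𝓝 (x, t)]
      fun _ => (0 : ℝ) := by
    filter_upwards [chart_source_mem_nhds (ModelProd H ℝ) (x, t)] with p hp
    refine (metricCoord_prodLine g hf hpos hp.1 t p.2 _ _).trans ?_
    simp
  rw [h.chartDeriv_eq]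
  simp [chartDeriv, Function.comp_def]

/-- Along `∂/∂t` only the factor `f` varies; this is the sole source of curvature of the slices. -/
theorem metricDeriv_prodLine_tangent (g : SmoothRiemannianMetric I M) {f : ℝ → ℝ}
    (hf : ContDiff ℝ ∞ f) (hpos : ∀ t, 0 < f t) (x : M) (t : ℝ) (v w : E) :
    metricDeriv (g.prodLine f hf hpos) (x, t) (0, 1) (v, 0) (w, 0) =
      deriv f t * metricCoord g x x v w := by
  rw [metricDeriv_apply]
  have h : (fun z => metricCoord (g.prodLine f hf hpos) (x, t) z (v, 0) (w, 0)) =ᶠ[𝓝 (x, t)]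
      fun z => f z.2 * metricCoord g x z.1 v w := by
    filter_upwards [chart_source_mem_nhds (ModelProd H ℝ) (x, t)] with p hp
    refine (metricCoord_prodLine g hf hpos hp.1 t p.2 _ _).trans ?_
    simp
  rw [h.chartDeriv_eq]
  have ha : MDifferentiableAt I 𝓘(ℝ, ℝ) (fun z => metricCoord g x z v w) x :=
    ((mdifferentiableAt_metricCoord g x).clm_apply mdifferentiableAt_const).clm_apply
      mdifferentiableAt_const
  -- The differential of the coefficient of `g` factors through the projection to `E`, so it kills
  -- `(0, 1)`.
  have h1 : HasFDerivWithinAt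
      (((fun z => metricCoord g x z v w) ∘ (extChartAt I x).symm) ∘ (Prod.fst : E × ℝ → E))
      ((chartDeriv I (fun z => metricCoord g x z v w) x).comp (ContinuousLinearMap.fst ℝ E ℝ))
      (Set.range (I.prod 𝓘(ℝ, ℝ))) (extChartAt (I.prod 𝓘(ℝ, ℝ)) (x, t) (x, t)) := by
    refine HasFDerivWithinAt.comp (t := Set.range I) _ ?_ hasFDerivWithinAt_fst ?_
    · exact ha.hasFDerivWithinAt_chartDeriv
    · rintro _ ⟨y, rfl⟩
      exact ⟨y.1, rfl⟩
  have h2 : HasFDerivWithinAt (f ∘ (Prod.snd : E × ℝ → ℝ))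
      ((ContinuousLinearMap.toSpanSingleton ℝ (deriv f t)).comp (ContinuousLinearMap.snd ℝ E ℝ))
      (Set.range (I.prod 𝓘(ℝ, ℝ))) (extChartAt (I.prod 𝓘(ℝ, ℝ)) (x, t) (x, t)) := by
    have h3 : HasFDerivAt f (ContinuousLinearMap.toSpanSingleton ℝ (deriv f t)) t :=
      ((hf.differentiable (by simp)) t).hasDerivAt.hasFDerivAt
    exact HasFDerivAt.comp_hasFDerivWithinAt _ h3 hasFDerivWithinAt_snd
  have h4 := h2.mul h1
  rw [HasFDerivWithinAt.chartDeriv_eq (I := I.prod 𝓘(ℝ, ℝ)) (x := (x, t))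
    (f := fun z : M × ℝ => f z.2 * metricCoord g x z.1 v w) h4]
  simp [mul_comm]

/-- A vector field which is tangent to the slice `M × {t₀}` has along it a derivative in tangential
coordinate directions which is tangent to the slice. -/
theorem chartDeriv_vectorFieldCoord_snd {Z : (y : M × ℝ) → TangentSpace (I.prod 𝓘(ℝ, ℝ)) y}
    {p : M} {t₀ : ℝ}
    (hZ : MDifferentiableAt (I.prod 𝓘(ℝ, ℝ)) ((I.prod 𝓘(ℝ, ℝ)).prod 𝓘(ℝ, E × ℝ))
      (fun y => TotalSpace.mk' (E × ℝ)
        (E := fun y : M × ℝ => TangentSpace (I.prod 𝓘(ℝ, ℝ)) y) y (Z y)) (p, t₀))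
    (htan : ∀ᶠ q in 𝓝 p, ((Z (q, t₀) : E × ℝ)).2 = 0) (u : E) :
    (chartDeriv (I.prod 𝓘(ℝ, ℝ)) (vectorFieldCoord (p, t₀) Z) (p, t₀) (u, 0)).2 = 0 := by
  have h1 := (mdifferentiableAt_vectorFieldCoord hZ).hasFDerivWithinAt_chartDeriv
  have hi : HasFDerivWithinAt (fun e : E => (e, t₀)) (ContinuousLinearMap.inl ℝ E ℝ) (Set.range I)
      (extChartAt I p p) := (hasFDerivAt_prodMk_left _ _).hasFDerivWithinAt
  -- The chain rule along `e ↦ (e, t₀)` turns the claim into one about the restriction to the slice,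
  -- where the line component is identically zero near `p`.
  have h2 : HasFDerivWithinAt (fun e : E =>
      (vectorFieldCoord (p, t₀) Z ((extChartAt I p).symm e, t₀)).2)
      ((ContinuousLinearMap.snd ℝ E ℝ).comp
        ((chartDeriv (I.prod 𝓘(ℝ, ℝ)) (vectorFieldCoord (p, t₀) Z) (p, t₀)).comp
          (ContinuousLinearMap.inl ℝ E ℝ))) (Set.range I) (extChartAt I p p) := by
    refine HasFDerivAt.comp_hasFDerivWithinAt _ hasFDerivAt_snd ?_
    refine HasFDerivWithinAt.comp (t := Set.range (I.prod 𝓘(ℝ, ℝ))) (extChartAt I p p) h1 hi ?_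
    rintro _ ⟨y, rfl⟩
    exact ⟨(y, t₀), rfl⟩
  have h3 : (fun q : M => (vectorFieldCoord (p, t₀) Z (q, t₀)).2) =ᶠ[𝓝 p] fun _ => (0 : ℝ) := by
    filter_upwards [htan, chart_source_mem_nhds H p] with q hq hqs
    exact (congrArg Prod.snd (trivializationAt_prod_line hqs t₀ t₀ (Z (q, t₀) : E × ℝ).1
      (Z (q, t₀) : E × ℝ).2)).trans hq
  have h4 := h3.chartDeriv_eq (I := I)
  rw [HasFDerivWithinAt.chartDeriv_eq (I := I) (x := p)
    (f := fun q : M => (vectorFieldCoord (p, t₀) Z (q, t₀)).2) h2] at h4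
  have h5 := congrArg (· u) h4
  simpa [chartDeriv, Function.comp_def] using h5

/-- The second fundamental form of the slice `M × {t₀}` for the metric `f(t) (g + dt²)`. -/
theorem isSecondFundamentalForm_slice [FiniteDimensional ℝ E] (g : SmoothRiemannianMetric I M)
    {f : ℝ → ℝ} (hf : ContDiff ℝ ∞ f) (hpos : ∀ t, 0 < f t) (t₀ : ℝ) :
    IsSecondFundamentalForm I (g.prodLine f hf hpos) (fun p : M => (p, t₀)) (sliceNormal I t₀)
      (fun p u v => -(deriv f t₀ / 2) * g.inner p u v) := by
  obtain ⟨D, hD, hform⟩ := exists_leviCivita (g.prodLine f hf hpos)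
  refine ⟨D, hD, fun p u Y Z hZ hYZ => ?_⟩
  have htan : ∀ᶠ q in 𝓝 p, ((Z (q, t₀) : E × ℝ)).2 = 0 := by
    filter_upwards [hYZ] with q hq
    rw [hq, mfderiv_slice]
  have hZp : (Z (p, t₀) : E × ℝ) = ((Y p, 0) : E × ℝ) := by
    rw [hYZ.self_of_nhds, mfderiv_slice]
  rw [mfderiv_slice]
  refine (hform Z (p, t₀) (u, 0) (0, 1)).trans ?_
  have h0 := metricDeriv_prodLine_normal g hf hpos p t₀
  have h1 := metricDeriv_prodLine_tangent g hf hpos p t₀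
  have h2 := chartDeriv_vectorFieldCoord_snd hZ htan
  -- Koszul terms paired with `∂/∂t`: the coordinate derivative is tangent to the slice, the two
  -- mixed terms vanish, and the `t`-derivative of the tangential metric remains with coefficient
  -- `-1/2`.
  have key (z : E × ℝ) (y u : E) (hz : z = (y, 0)) :
      (g.prodLine f hf hpos).inner (p, t₀)
        (chartDeriv (I.prod 𝓘(ℝ, ℝ)) (vectorFieldCoord (p, t₀) Z) (p, t₀) (u, 0) : E × ℝ)
        ((0, 1) : E × ℝ) +
      (metricDeriv (g.prodLine f hf hpos) (p, t₀) (u, 0) z (0, 1)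
        + metricDeriv (g.prodLine f hf hpos) (p, t₀) z (u, 0) (0, 1)
        - metricDeriv (g.prodLine f hf hpos) (p, t₀) (0, 1) z (u, 0)) / 2 =
      -(deriv f t₀ / 2) * metricCoord g p p y u := by
    rw [hz, h0, h0, h1]
    have h3 (q : E × ℝ) (hq : q.2 = 0) :
        (g.prodLine f hf hpos).inner (p, t₀) q ((0, 1) : E × ℝ) = 0 := by
      refine (g.prodLine_inner f hf hpos p t₀ q.1 0 q.2 1).trans ?_
      rw [hq]
      simp
    rw [h3 _ (h2 u)]
    ring
  refine (key _ _ _ hZp).trans ?_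
  rw [metricCoord_self, g.symm]

end Slices

end

/-! ### The two choices of the conformal factor. -/

theorem theorem4p4 (n : ℕ) (M : Type*) [TopologicalSpace M] [T2Space M]
    [SecondCountableTopology M] [ChartedSpace (EuclideanSpace ℝ (Fin (4 * n + 3))) M]
    [IsManifold (𝓡 (4 * n + 3)) ∞ M]
    (S : AlmostCoquaternionMetricStructure (𝓡 (4 * n + 3)) M) :
    ∃ Q : AlmostQuaternionHermitianStructure ((𝓡 (4 * n + 3)).prod 𝓘(ℝ, ℝ)) (M × ℝ),
      -- `Q` is the structure `J_a (X, r) = (φ_a X + r ξ_a, -η_a X)`, `G = g + dt²`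
      (∀ (a : Fin 3) (x : M) (t : ℝ) (X : TangentSpace (𝓡 (4 * n + 3)) x) (r : ℝ),
        Q.J a (x, t) (X, r) = ((S.str a).φ x X + r • (S.str a).ξ x, -(S.str a).η x X)) ∧
      (∀ (x : M) (t : ℝ) (X Y : TangentSpace (𝓡 (4 * n + 3)) x) (r s : ℝ),
        Q.G.inner (x, t) (X, r) (Y, s) = S.g.inner x X Y + r * s) ∧
      -- every slice is a totally geodesic copy of `M`
      (∀ t₀ : ℝ, ∃ ν : (p : M) → TangentSpace ((𝓡 (4 * n + 3)).prod 𝓘(ℝ, ℝ)) (p, t₀),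
        IsHypersurfaceWithUnitNormal (𝓡 (4 * n + 3)) Q.G (fun p : M => (p, t₀)) ν ∧
        InducesStructure Q (fun p : M => (p, t₀)) ν S ∧
        IsTotallyGeodesic (𝓡 (4 * n + 3)) Q.G (fun p : M => (p, t₀)) ν) ∧
      -- for another Hermitian metric and the same `J_a`, the slice `t = 0` is a totally umbilical
      -- copy of `M` that is nowhere geodesic
      (∃ Q' : AlmostQuaternionHermitianStructure ((𝓡 (4 * n + 3)).prod 𝓘(ℝ, ℝ)) (M × ℝ),
        Q'.J = Q.J ∧
        ∃ (ν : (p : M) → TangentSpace ((𝓡 (4 * n + 3)).prod 𝓘(ℝ, ℝ)) (p, (0 : ℝ)))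
          (lam : M → ℝ),
          IsHypersurfaceWithUnitNormal (𝓡 (4 * n + 3)) Q'.G (fun p : M => (p, (0 : ℝ))) ν ∧
          InducesStructure Q' (fun p : M => (p, (0 : ℝ))) ν S ∧
          (∀ p, lam p ≠ 0) ∧
          IsTotallyUmbilical (𝓡 (4 * n + 3)) Q'.G (fun p : M => (p, (0 : ℝ))) ν lam) := by
  -- Chosen positive with `f 0 = 1`, so that the slice `t = 0` inherits `g`, and with `f' 0 = -2`,
  -- so that `-(f' 0)/2 = 1` is the principal curvature.
  let f : ℝ → ℝ := fun t => Real.exp (-2 * t)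
  have hf : ContDiff ℝ ∞ f := by fun_prop
  have hf0 : f 0 = 1 := by simp [f]
  have hf' : deriv f 0 = -2 := by
    have h : HasDerivAt f (Real.exp (-2 * 0) * (-2 * 1)) 0 :=
      ((hasDerivAt_id (0 : ℝ)).const_mul (-2)).exp
    rw [h.deriv]
    simp
  refine ⟨S.prodLine (fun _ => 1) contDiff_const (fun _ => one_pos), ?_, ?_, fun t₀ => ?_,
    S.prodLine f hf (fun t => Real.exp_pos _), rfl, sliceNormal _ 0, fun _ => 1, ?_, ?_, ?_, ?_⟩
  · intro a x t X r
    exact productEndomorphism_apply _ _ _ _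
  · intro x t X Y r s
    exact (S.g.prodLine_inner (fun _ => 1) contDiff_const (fun _ => one_pos) x t X Y r s).trans
      (one_mul _)
  · refine ⟨sliceNormal _ t₀, isHypersurfaceWithUnitNormal_slice S.g
      (f := fun _ => 1) contDiff_const (fun _ => one_pos) rfl,
      inducesStructure_slice S (f := fun _ => 1) contDiff_const (fun _ => one_pos) rfl, ?_⟩
    have h := isSecondFundamentalForm_slice S.g (f := fun _ => 1) contDiff_const
      (fun _ => one_pos) t₀
    simp only [deriv_const, zero_div, neg_zero, zero_mul] at h
    exact h
  · exact isHypersurfaceWithUnitNormal_slice S.g hf (fun t => Real.exp_pos _) hf0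
  · exact inducesStructure_slice S hf (fun t => Real.exp_pos _) hf0
  · exact fun _ => one_ne_zero
  · have h := isSecondFundamentalForm_slice S.g hf (fun t => Real.exp_pos _) 0
    have hS := inducesStructure_slice S hf (fun t => Real.exp_pos _) hf0
    -- Umbilicity is stated with the metric induced by `G'`, which is `g` on this slice.
    have he : (fun (p : M) (u v : TangentSpace (𝓡 (4 * n + 3)) p) =>
        -(deriv f 0 / 2) * S.g.inner p u v) = fun p u v => 1 *
          (S.prodLine f hf (fun t => Real.exp_pos _)).G.inner (p, (0 : ℝ))
            (mfderiv (𝓡 (4 * n + 3)) ((𝓡 (4 * n + 3)).prod 𝓘(ℝ, ℝ))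
              (fun p : M => (p, (0 : ℝ))) p u)
            (mfderiv (𝓡 (4 * n + 3)) ((𝓡 (4 * n + 3)).prod 𝓘(ℝ, ℝ))
              (fun p : M => (p, (0 : ℝ))) p v) := by
      funext p u v
      rw [hS.metric, hf']
      norm_num
    rw [he] at h
    exact h
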